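/- A network $Q$ is a finite connected graph (loops and parallel edges allowed) each of whose edges is identified with an open interval of a given positive length; $Q$ carries the shortest-path metric and the measure $\lambda$ (length), which is Lebesgue measure on every edge, and $\lambda(Q)=1$. In the booby trap game on $Q$ with one trap, the defender chooses a point $y\in Q$ and the attacker chooses a connected subset $C\subseteq Q$; the attacker receives $\lambda(C)$ if $y\notin C$ and $0$ otherwise. The attacker maximizes and the defender minimizes the expected payoff, and both may randomize. A point $x\in Q$ is a centroid of $Q$ if $Q\setminus\{x\}$ is disconnected and each of its connected components has length at most $1/2$. Suppose that $Q$ has a centroid $x$, that $Q\setminus\{x\}$ has exactly $n$ connected components $A_1,\dots,A_n$, each of length $1/n$, and that $n$ is even. Then the value of the game is $\frac{n}{n^2+4}$, and the following strategies are optimal. (i) The attacker's partition strategy. Let $a_i=\lambda(A_i)$. For nonempty $S\subseteq\{1,\dots,n\}$ let $D(S)=\sum_{j\notin S}\frac1{a_j}+\frac{1}{\sum_{j\in S}a_j}$ and $W(S)=\frac{n-|S|}{D(S)}$. The partition strategy chooses a nonempty $S$ that maximizes $W(S)$, and takes $A_i$ with probability $\frac{1/a_i}{D(S)}$ for each $i\notin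 S$, and $\{x\}\cup\bigcup_{j\in S}A_j$ with probability $\frac{1/\sum_{j\in S}a_j}{D(S)}$. (It is optimal for every maximizing $S$.) (ii) The defender's centroid strategy. Let $a_1=1/n$ be the length of the longest component and $p=\frac{4a_1}{1+4a_1^2}$. With probability $p$ the trap is placed uniformly on $Q$ (according to $\lambda$), and with probability $1-p$ it is placed at $x$. -/

import Mathlib

open Set MeasureTheory
open scoped ENNReal

universe u v

/-- A network: a finite connected graph (loops and parallel edges allowed) whose edges carry
positive lengths, rescaled so that the total length is `1`. -/
structure Network where
  V : Type u
  E : Type v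
  [fintypeV : Fintype V]
  [fintypeE : Fintype E]
  src : E → V
  tgt : E → V
  len : E → ℝ
  len_pos : ∀ e, 0 < len e
  connected : ∀ a b : V, Relation.EqvGen (fun a b => ∃ e, src e = a ∧ tgt e = b) a b
  total_len : ∑ e, len e = 1

namespace Network

attribute [instance] Network.fintypeV Network.fintypeE

/-- The points of the network: its nodes, and for every arc `e` an open interval of length
`len e`. -/
inductive Point (N : Network.{u, v}) : Type (max u v)
  | node (a : N.V) : Point N
  | interior (e : N.E) (t : ℝ) (ht : t ∈ Ioo 0 (N.len e)) : Point N

variable (N : Network.{u, v})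

open Classical in
/-- Parametrization of the closed arc `e` by `[0, len e]`, from `src e` to `tgt e`
(and constant on each side outside this interval). -/
noncomputable def arc (e : N.E) (t : ℝ) : N.Point :=
  if h : t ∈ Ioo 0 (N.len e) then Point.interior e t h
  else if t ≤ 0 then Point.node (N.src e) else Point.node (N.tgt e)

/-- `N.HasPath p q L`: there is a path of length `L` from `p` to `q`, made of finitely many
segments, each contained in a closed arc. -/
inductive HasPath : N.Point → N.Point → ℝ → Prop
  | refl (p : N.Point) : HasPath p p 0
  | step {p : N.Point} {L : ℝ} (e : N.E) {s t : ℝ} (hs : s ∈ Icc 0 (N.len e))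
      (ht : t ∈ Icc 0 (N.len e)) (h : HasPath p (N.arc e s) L) :
      HasPath p (N.arc e t) (L + |t - s|)

/-- The shortest path distance. -/
noncomputable def pathDist (p q : N.Point) : ℝ := sInf {L | N.HasPath p q L}

/-! The shortest path distance is a metric. -/

variable {N}

theorem arc_zero (e : N.E) : N.arc e 0 = Point.node (N.src e) := by
  simp [arc]

theorem arc_len (e : N.E) : N.arc e (N.len e) = Point.node (N.tgt e) := by
  simp [arc, N.len_pos e]

theorem arc_interior (e : N.E) (t : ℝ) (ht : t ∈ Ioo 0 (N.len e)) :
    N.arc e t = Point.interior e t ht := by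
  rw [arc, dif_pos ht]

theorem HasPath.nonneg {p q : N.Point} {L : ℝ} (h : N.HasPath p q L) : 0 ≤ L := by
  induction h with
  | refl => exact le_rfl
  | step e hs ht h ih => positivity

theorem HasPath.trans {p q r : N.Point} {L M : ℝ} (h : N.HasPath p q L)
    (h' : N.HasPath q r M) : N.HasPath p r (L + M) := by
  induction h' with
  | refl => simpa using h
  | step e hs ht _ ih => rw [← add_assoc]; exact HasPath.step e hs ht ih

theorem HasPath.seg (e : N.E) {s t : ℝ} (hs : s ∈ Icc 0 (N.len e))
    (ht : t ∈ Icc 0 (N.len e)) : N.HasPath (N.arc e s) (N.arc e t) |t - s| := by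
  simpa using HasPath.step e hs ht (HasPath.refl _)

theorem HasPath.symm {p q : N.Point} {L : ℝ} (h : N.HasPath p q L) : N.HasPath q p L := by
  induction h with
  | refl => exact HasPath.refl _
  | step e hs ht _ ih =>
    rw [add_comm, abs_sub_comm]
    exact (HasPath.seg e ht hs).trans ih

theorem HasPath.exists_node (p : N.Point) : ∃ a L, N.HasPath p (Point.node a) L := by
  cases p with
  | node a => exact ⟨a, 0, HasPath.refl _⟩
  | interior e t ht =>
    refine ⟨N.src e, |0 - t|, ?_⟩
    rw [← arc_interior e t ht, ← arc_zero]
    exact HasPath.seg e ⟨ht.1.le, ht.2.le⟩ ⟨le_rfl, (N.len_pos e).le⟩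

theorem HasPath.exists_path (p q : N.Point) : ∃ L, N.HasPath p q L := by
  have key : ∀ a b : N.V, ∃ L, N.HasPath (Point.node a) (Point.node b) L := by
    intro a b
    induction N.connected a b with
    | rel a b h =>
      obtain ⟨e, rfl, rfl⟩ := h
      rw [← arc_zero, ← arc_len]
      exact ⟨_, HasPath.seg e ⟨le_rfl, (N.len_pos e).le⟩ ⟨(N.len_pos e).le, le_rfl⟩⟩
    | refl a => exact ⟨0, HasPath.refl _⟩
    | symm a b _ ih => exact ih.imp fun L h => h.symm
    | trans a b c _ _ ih ih' =>
      obtain ⟨L, h⟩ := ih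
      obtain ⟨M, h'⟩ := ih'
      exact ⟨_, h.trans h'⟩
  obtain ⟨a, L, h⟩ := HasPath.exists_node p
  obtain ⟨b, M, h'⟩ := HasPath.exists_node q
  obtain ⟨K, k⟩ := key a b
  exact ⟨_, (h.trans k).trans h'.symm⟩

theorem pathDist_le {p q : N.Point} {L : ℝ} (h : N.HasPath p q L) : N.pathDist p q ≤ L :=
  csInf_le ⟨0, fun _ h => HasPath.nonneg h⟩ h

theorem exists_path_lt {p q : N.Point} {r : ℝ} (h : N.pathDist p q < r) :
    ∃ L < r, N.HasPath p q L := by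
  obtain ⟨L, hL, hr⟩ := exists_lt_of_csInf_lt (HasPath.exists_path p q) h
  exact ⟨L, hr, hL⟩

theorem pathDist_nonneg (p q : N.Point) : 0 ≤ N.pathDist p q :=
  Real.sInf_nonneg fun _ h => HasPath.nonneg h

theorem pathDist_self (p : N.Point) : N.pathDist p p = 0 :=
  le_antisymm (pathDist_le (HasPath.refl p)) (pathDist_nonneg p p)

theorem pathDist_comm (p q : N.Point) : N.pathDist p q = N.pathDist q p := by
  unfold pathDist
  congr 1
  ext L
  exact ⟨HasPath.symm, HasPath.symm⟩

theorem pathDist_triangle (p q r : N.Point) :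
    N.pathDist p r ≤ N.pathDist p q + N.pathDist q r := by
  refine le_of_forall_pos_le_add fun ε hε => ?_
  obtain ⟨L, hL, h⟩ := exists_path_lt (show N.pathDist p q < N.pathDist p q + ε / 2 by linarith)
  obtain ⟨M, hM, h'⟩ := exists_path_lt (show N.pathDist q r < N.pathDist q r + ε / 2 by linarith)
  linarith [pathDist_le (h.trans h')]

theorem le_pathDist (f : N.Point → ℝ)
    (hf : ∀ e, ∀ s ∈ Icc 0 (N.len e), ∀ t ∈ Icc 0 (N.len e),
      f (N.arc e t) ≤ f (N.arc e s) + |t - s|) (p q : N.Point) :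
    f q ≤ f p + N.pathDist p q := by
  have key : ∀ L, N.HasPath p q L → f q ≤ f p + L := by
    intro L h
    induction h with
    | refl => simp
    | step e hs ht _ ih => linarith [hf e _ hs _ ht]
  have : f q - f p ≤ N.pathDist p q :=
    le_csInf (HasPath.exists_path p q) fun L h => by linarith [key L h]
  linarith

theorem exists_pos_le_len (N : Network.{u, v}) : ∃ r > 0, ∀ e, r ≤ N.len e := by
  cases isEmpty_or_nonempty N.E with
  | inl h => exact ⟨1, one_pos, fun e => isEmptyElim e⟩
  | inr h =>
    obtain ⟨e, he⟩ := Finite.exists_min N.len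
    exact ⟨N.len e, N.len_pos e, he⟩

open Classical in
theorem eq_of_pathDist_eq_zero {p q : N.Point} (h : N.pathDist p q = 0) : p = q := by
  cases p with
  | node a =>
    obtain ⟨r, hr, hle⟩ := exists_pos_le_len N
    let f : N.Point → ℝ := fun q => match q with
      | Point.node b => if b = a then 0 else r
      | Point.interior e t _ => min r (min (if N.src e = a then t else r)
          (if N.tgt e = a then N.len e - t else r))
    have harc : ∀ e, ∀ t ∈ Icc 0 (N.len e), f (N.arc e t) =
        min r (min (if N.src e = a then t else r) (if N.tgt e = a then N.len e - t else r)) := by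
      intro e t ht
      have := hle e
      rcases eq_or_lt_of_le ht.1 with rfl | h0
      · rw [arc_zero]
        simp only [f]
        split_ifs <;> simp <;> grind
      rcases eq_or_lt_of_le ht.2 with rfl | h1
      · rw [arc_len]
        simp only [f]
        split_ifs <;> simp <;> grind
      · rw [arc_interior e t ⟨h0, h1⟩]
    have hq := le_pathDist f (by
      intro e s hs t ht
      rw [harc e s hs, harc e t ht]
      split_ifs <;> grind) (Point.node a) q
    rw [h] at hq
    cases q with
    | node b =>
      by_contra hne
      have : b ≠ a := fun hb => hne (by rw [hb])
      simp [f, this] at hq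
      linarith
    | interior e t ht =>
      exfalso
      obtain ⟨h0, h1⟩ := ht
      simp only [f] at hq
      split_ifs at hq <;> grind
  | interior e₀ t₀ ht₀ =>
    obtain ⟨h0, h1⟩ := ht₀
    let r := min t₀ (N.len e₀ - t₀)
    have hr : 0 < r := lt_min h0 (by linarith)
    let f : N.Point → ℝ := fun q => match q with
      | Point.node b => r
      | Point.interior e t _ => if e = e₀ then min |t - t₀| r else r
    have harc : ∀ e, ∀ t ∈ Icc 0 (N.len e), f (N.arc e t) =
        if e = e₀ then min |t - t₀| r else r := by
      intro e t ht
      rcases eq_or_lt_of_le ht.1 with rfl | h0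
      · rw [arc_zero]
        simp only [f]
        split_ifs <;> grind
      rcases eq_or_lt_of_le ht.2 with rfl | h1
      · rw [arc_len]
        simp only [f]
        split_ifs <;> grind
      · rw [arc_interior e t ⟨h0, h1⟩]
    have hq := le_pathDist f (by
      intro e s hs t ht
      rw [harc e s hs, harc e t ht]
      split_ifs <;> grind) (Point.interior e₀ t₀ ⟨h0, h1⟩) q
    rw [h] at hq
    cases q with
    | node b =>
      exfalso
      simp only [f] at hq
      grind
    | interior e t ht =>
      have : e = e₀ ∧ t = t₀ := by
        simp only [f] at hq
        split_ifs at hq <;> grind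
      obtain ⟨rfl, rfl⟩ := this
      rfl

noncomputable instance : MetricSpace N.Point where
  dist := N.pathDist
  dist_self := pathDist_self
  dist_comm := pathDist_comm
  dist_triangle := pathDist_triangle
  eq_of_dist_eq_zero := eq_of_pathDist_eq_zero

noncomputable instance : MeasurableSpace N.Point := borel N.Point

instance : BorelSpace N.Point := ⟨rfl⟩

variable (N)

/-- Length, as a measure on the network: Lebesgue measure on every (open) arc. -/
noncomputable def length : Measure N.Point :=
  ∑ e, (volume.restrict (Ioo 0 (N.len e))).map (N.arc e)

/-! ### Removing a point; centroids -/

/-- The connected components of the network with the point `x` removed. -/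
def components (x : N.Point) : Set (Set N.Point) :=
  {C | ∃ y ∈ ({x}ᶜ : Set N.Point), C = connectedComponentIn {x}ᶜ y}

/-- `h(x)`: the maximum length of a connected component of the network without `x`. -/
noncomputable def radius (x : N.Point) : ℝ≥0∞ := ⨆ C ∈ N.components x, N.length C

/-- `x` is a centroid: its removal disconnects the network, and no component that remains is
longer than `1/2`. -/
def IsCentroid (x : N.Point) : Prop :=
  ¬ IsPreconnected ({x}ᶜ : Set N.Point) ∧ N.radius x ≤ 1 / 2

/-- `A 0, …, A (n - 1)` lists, without repetition, the components into which the removal of `x`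
breaks the network. -/
def IsSplitting (x : N.Point) {n : ℕ} (A : Fin n → Set N.Point) : Prop :=
  Function.Injective A ∧ range A = N.components x

/-! ### The booby trap game with one booby trap -/

open Classical in
/-- The reward of the attacker who takes `S` when the booby trap is at `y`. -/
noncomputable def payoff (S : Set N.Point) (y : N.Point) : ℝ≥0∞ :=
  if y ∈ S then 0 else N.length S

/-- A random subset of the network: a map from a measure space to the subsets. -/
structure RandomSet where
  Ω : Type
  [mΩ : MeasurableSpace Ω]
  P : Measure Ω
  set : Ω → Set N.Point

attribute [instance] RandomSet.mΩ

/-- The mixed strategies of the attacker: random connected subsets (with measurable graph). -/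
structure IsAttack (σ : N.RandomSet) : Prop where
  prob : IsProbabilityMeasure σ.P
  connected : ∀ ω, IsConnected (σ.set ω)
  measurable : MeasurableSet {z : σ.Ω × N.Point | z.2 ∈ σ.set z.1}

/-- The mixed strategies of the defender: Borel probability measures, the law of the position of
the booby trap. -/
abbrev IsDefence (τ : Measure N.Point) : Prop := IsProbabilityMeasure τ

/-- The expected payoff to the attacker. -/
noncomputable def expectedPayoff (σ : N.RandomSet) (τ : Measure N.Point) : ℝ≥0∞ :=
  ∫⁻ ω, ∫⁻ y, N.payoff (σ.set ω) y ∂τ ∂σ.P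

/-- The expected payoff that the strategy `σ` guarantees to the attacker. -/
noncomputable def attackGuarantee (σ : N.RandomSet) : ℝ≥0∞ :=
  ⨅ (τ : Measure N.Point) (_ : N.IsDefence τ), N.expectedPayoff σ τ

/-- The bound on the attacker's expected payoff that the strategy `τ` guarantees to the
defender. -/
noncomputable def defenceGuarantee (τ : Measure N.Point) : ℝ≥0∞ :=
  ⨆ (σ : N.RandomSet) (_ : N.IsAttack σ), N.expectedPayoff σ τ

/-- The game has the value `w`: maximin and minimax are both equal to `w`. -/
def HasValue (w : ℝ≥0∞) : Prop :=
  (⨆ (σ : N.RandomSet) (_ : N.IsAttack σ), N.attackGuarantee σ) = w ∧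
  (⨅ (τ : Measure N.Point) (_ : N.IsDefence τ), N.defenceGuarantee τ) = w

/-- `σ` is an optimal strategy of the attacker. -/
def IsOptimalAttack (σ : N.RandomSet) : Prop :=
  N.IsAttack σ ∧ ∀ σ', N.IsAttack σ' → N.attackGuarantee σ' ≤ N.attackGuarantee σ

/-- `τ` is an optimal strategy of the defender. -/
def IsOptimalDefence (τ : Measure N.Point) : Prop :=
  N.IsDefence τ ∧ ∀ τ', N.IsDefence τ' → N.defenceGuarantee τ ≤ N.defenceGuarantee τ'

/-! ### The centroid strategy and the partition strategy -/

/-- The centroid strategy: with probability `p = 4 a / (1 + 4 a ^ 2)`, where `a` is the length of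
the longest component without `x`, hide the booby trap uniformly on the network; otherwise plant
it at `x`. -/
noncomputable def centroidStrategy (x : N.Point) : Measure N.Point :=
  let a : ℝ := (N.radius x).toReal
  let p : ℝ := 4 * a / (1 + 4 * a ^ 2)
  ENNReal.ofReal p • N.length + ENNReal.ofReal (1 - p) • Measure.dirac x

variable {n : ℕ} (A : Fin n → Set N.Point)

/-- The length of the `i`-th component. -/
noncomputable def compLength (i : Fin n) : ℝ := (N.length (A i)).toReal

/-- The normalizing constant `∑_{j ∉ S} 1 / a_j + 1 / ∑_{j ∈ S} a_j`. -/
noncomputable def partitionDenom (S : Finset (Fin n)) : ℝ :=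
  ∑ j ∈ Sᶜ, 1 / N.compLength A j + 1 / ∑ j ∈ S, N.compLength A j

/-- `W(S) = (n - |S|) / (∑_{j ∉ S} 1 / a_j + 1 / ∑_{j ∈ S} a_j)`. -/
noncomputable def W (S : Finset (Fin n)) : ℝ := ((n : ℝ) - S.card) / N.partitionDenom A S

/-- The attacker's strategy given by a set `S` of components: take the whole of the component
`i ∉ S` with probability proportional to `1 / a_i` (outcome `inl i`), or all components in `S`
along with `x` with probability proportional to `1 / ∑_{j ∈ S} a_j` (outcome `inr ()`). -/
noncomputable def consolidate (x : N.Point) (S : Finset (Fin n)) : N.RandomSet where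
  Ω := {i : Fin n // i ∉ S} ⊕ Unit
  P := ∑ i : {i : Fin n // i ∉ S},
        ENNReal.ofReal (1 / N.compLength A i / N.partitionDenom A S) •
          Measure.dirac (Sum.inl i) +
      ENNReal.ofReal (1 / (∑ j ∈ S, N.compLength A j) / N.partitionDenom A S) •
        Measure.dirac (Sum.inr ())
  set := Sum.elim (fun i => A i) (fun _ => insert x (⋃ j ∈ S, A j))

/-- `σ` is a partition strategy: it is given by a nonempty set `S` of components that
maximizes `W`. -/
def IsPartitionStrategy (x : N.Point) (σ : N.RandomSet) : Prop :=
  ∃ S : Finset (Fin n), S.Nonempty ∧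
    (∀ T : Finset (Fin n), T.Nonempty → N.W A T ≤ N.W A S) ∧ σ = N.consolidate A x S

end Network

namespace Network

variable {N : Network.{u, v}}

/-! Both strategies guarantee `w = n / (n ^ 2 + 4)`, and weak duality does the rest.

Attacker: the pieces of a partition strategy partition the network, and each is taken with
probability inversely proportional to its length. A piece `C` thus contributes `(1 - τ C) / D`
against a trap law `τ`. There are `n - |S| + 1` pieces and the `τ C` sum to `1`, so the expected
payoff is `W(S)` whatever `τ` is (`expectedPayoff_consolidate`). Half of the components give `W(S) =
w`, so a maximizing `S` gives at least `w`.

Defender: here `p = 4 w`. A set of length `l` containing `x` earns `4 w l (1 - l) ≤ w`. A connected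
set avoiding `x` lies in one component, so `l ≤ 1 / n`, and it earns `l (1 - 4 w l)`, which
increases up to `w` at `l = 1 / n` (`defenceGuarantee_centroidStrategy_le`).

The topological input is that components are open (hence measurable) and have `x` in their closure
(so that uniting them with `x` gives a connected set). -/

/-! ### Topology and length of the network -/

theorem dist_arc_le (e : N.E) {s t : ℝ} (hs : s ∈ Icc 0 (N.len e)) (ht : t ∈ Icc 0 (N.len e)) :
    dist (N.arc e s) (N.arc e t) ≤ |t - s| :=
  pathDist_le (HasPath.seg e hs ht)

theorem arc_eq_arc_projIcc (e : N.E) (t : ℝ) :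
    N.arc e t = N.arc e (projIcc 0 (N.len e) (N.len_pos e).le t) := by
  have hl := N.len_pos e
  rcases le_total t 0 with h | h
  · rw [projIcc_of_le_left _ h, arc_zero]
    simp [arc, h, not_lt.2 h]
  rcases le_total (N.len e) t with h' | h'
  · rw [projIcc_of_right_le _ h', arc_len]
    have : ¬ t ≤ 0 := by linarith
    simp [arc, this, not_lt.2 h']
  · rw [projIcc_of_mem _ ⟨h, h'⟩]

/-- The parametrization is a clamp to `[0, len e]` followed by a 1-Lipschitz map. -/
theorem continuous_arc (e : N.E) : Continuous (N.arc e) := by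
  have h : Continuous fun t : Icc 0 (N.len e) => N.arc e t :=
    (LipschitzWith.of_dist_le_mul (K := 1) fun s t => by
      rw [NNReal.coe_one, one_mul, Subtype.dist_eq, Real.dist_eq, abs_sub_comm]
      exact dist_arc_le e s.2 t.2).continuous
  exact (h.comp continuous_projIcc).congr fun t => (arc_eq_arc_projIcc e t).symm

/-- A path of length less than `r` starting at `p` stays in the ball of radius `r` around `p`. -/
theorem HasPath.exists_isPreconnected {p q : N.Point} {L : ℝ} (h : N.HasPath p q L) {r : ℝ}
    (hr : L < r) : ∃ t ⊆ Metric.ball p r, p ∈ t ∧ q ∈ t ∧ IsPreconnected t := by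
  induction h with
  | refl => exact ⟨{p}, by simpa using hr, rfl, rfl, isPreconnected_singleton⟩
  | @step L e s t hs ht h ih =>
    obtain ⟨T, hT, hp, hq, hc⟩ := ih (by linarith [abs_nonneg (t - s)])
    refine ⟨T ∪ N.arc e '' uIcc s t, union_subset hT ?_, Or.inl hp,
      Or.inr ⟨t, right_mem_uIcc, rfl⟩, hc.union (N.arc e s) hq ⟨s, left_mem_uIcc, rfl⟩
        (isPreconnected_uIcc.image _ (continuous_arc e).continuousOn)⟩
    rintro _ ⟨w, hw, rfl⟩
    rw [Metric.mem_ball, dist_comm]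
    have h1 : |w - s| ≤ |t - s| := abs_sub_left_of_mem_uIcc hw
    have h2 : w ∈ Icc 0 (N.len e) := (convex_Icc 0 (N.len e)).ordConnected.uIcc_subset hs ht hw
    -- Stopping the last segment early, at `w`, gives a path no longer than the original.
    exact (pathDist_le (h.step e hs h2)).trans_lt (by linarith)

theorem isPreconnected_ball (p : N.Point) (r : ℝ) : IsPreconnected (Metric.ball p r) := by
  refine isPreconnected_of_forall p fun q hq => ?_
  rw [Metric.mem_ball, dist_comm] at hq
  obtain ⟨L, hL, h⟩ := exists_path_lt hq
  exact h.exists_isPreconnected hL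

instance : PreconnectedSpace N.Point := by
  refine ⟨isPreconnected_of_forall_pair fun p _ q _ => ?_⟩
  obtain ⟨L, h⟩ := HasPath.exists_path p q
  obtain ⟨t, -, ht⟩ := h.exists_isPreconnected (lt_add_one L)
  exact ⟨t, subset_univ _, ht⟩

/-- Local connectedness is what makes the components of an open set open. -/
instance : LocallyConnectedSpace N.Point :=
  locallyConnectedSpace_of_connected_bases (fun p r => Metric.ball p r) (fun _ r => 0 < r)
    (fun _ => Metric.nhds_basis_ball) fun p r _ => isPreconnected_ball p r

theorem measurable_arc (e : N.E) : Measurable (N.arc e) := (continuous_arc e).measurable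

theorem injOn_arc (e : N.E) : InjOn (N.arc e) (Ioo 0 (N.len e)) := by
  intro s hs t ht h
  rw [arc_interior e s hs, arc_interior e t ht] at h
  simpa using h

theorem length_apply {S : Set N.Point} (hS : MeasurableSet S) :
    N.length S = ∑ e, volume (N.arc e ⁻¹' S ∩ Ioo 0 (N.len e)) := by
  rw [length, Measure.finsetSum_apply]
  exact Finset.sum_congr rfl fun e _ => by
    rw [Measure.map_apply (measurable_arc e) hS,
      Measure.restrict_apply (measurable_arc e hS)]

instance : IsProbabilityMeasure N.length := by
  constructor
  rw [length_apply .univ]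
  simp only [preimage_univ, univ_inter, Real.volume_Ioo, sub_zero]
  rw [← ENNReal.ofReal_sum_of_nonneg fun e _ => (N.len_pos e).le, N.total_len, ENNReal.ofReal_one]

/-- Each open arc meets a point at most once. Hence adjoining `x` to a set costs no length. -/
instance : NullSingletonClass N.length := by
  refine ⟨fun x => ?_⟩
  rw [length_apply (measurableSet_singleton x)]
  refine Finset.sum_eq_zero fun e _ => Set.Subsingleton.measure_zero (fun s hs t ht => ?_) _
  exact injOn_arc e hs.2 ht.2 (hs.1.trans ht.1.symm)

/-! ### Components -/

theorem isOpen_of_mem_components {x : N.Point} {C : Set N.Point} (hC : C ∈ N.components x) :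
    IsOpen C := by
  obtain ⟨y, -, rfl⟩ := hC
  exact isOpen_compl_singleton.connectedComponentIn

theorem isConnected_of_mem_components {x : N.Point} {C : Set N.Point} (hC : C ∈ N.components x) :
    IsConnected C := by
  obtain ⟨y, hy, rfl⟩ := hC
  exact isConnected_connectedComponentIn_iff.2 hy

theorem notMem_of_mem_components {x : N.Point} {C : Set N.Point} (hC : C ∈ N.components x) :
    x ∉ C := by
  obtain ⟨y, -, rfl⟩ := hC
  exact fun h => connectedComponentIn_subset _ _ h rfl

theorem subset_of_mem_components {x : N.Point} {C T : Set N.Point} (hC : C ∈ N.components x)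
    (hT : IsPreconnected T) (hx : x ∉ T) (h : (T ∩ C).Nonempty) : T ⊆ C := by
  obtain ⟨y, -, rfl⟩ := hC
  obtain ⟨z, hz, hz'⟩ := h
  rw [connectedComponentIn_eq hz']
  exact hT.subset_connectedComponentIn hz (subset_compl_singleton_iff.2 hx)

theorem eq_of_mem_components {x : N.Point} {C D : Set N.Point} (hC : C ∈ N.components x)
    (hD : D ∈ N.components x) (h : (C ∩ D).Nonempty) : C = D :=
  (subset_of_mem_components hD (isConnected_of_mem_components hC).2
    (notMem_of_mem_components hC) h).antisymm
  (subset_of_mem_components hC (isConnected_of_mem_components hD).2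
    (notMem_of_mem_components hD) (inter_comm C D ▸ h))

/-- Otherwise `C` could not grow under closure, by maximality, so it would be clopen and nonempty in
a connected space, hence everything, including `x`. -/
theorem mem_closure_of_mem_components {x : N.Point} {C : Set N.Point}
    (hC : C ∈ N.components x) : x ∈ closure C := by
  by_contra hx
  have hcl : IsClosed C := closure_subset_iff_isClosed.1 <|
    subset_of_mem_components hC (isConnected_of_mem_components hC).2.closure hx
      ((isConnected_of_mem_components hC).1.mono fun y hy => ⟨subset_closure hy, hy⟩)
  have huniv := IsClopen.eq_univ ⟨hcl, isOpen_of_mem_components hC⟩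
    (isConnected_of_mem_components hC).1
  exact notMem_of_mem_components hC (huniv ▸ mem_univ x)

theorem isConnected_insert_of_mem_components {x : N.Point} {C : Set N.Point}
    (hC : C ∈ N.components x) : IsConnected (insert x C) :=
  (isConnected_of_mem_components hC).subset_closure (subset_insert x C)
    (insert_subset (mem_closure_of_mem_components hC) subset_closure)

namespace IsSplitting

variable {x : N.Point} {n : ℕ} {A : Fin n → Set N.Point}

theorem mem_components (hA : N.IsSplitting x A) (i : Fin n) : A i ∈ N.components x :=
  hA.2 ▸ mem_range_self i

theorem measurableSet (hA : N.IsSplitting x A) (i : Fin n) : MeasurableSet (A i) :=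
  (isOpen_of_mem_components (hA.mem_components i)).measurableSet

theorem pairwise_disjoint (hA : N.IsSplitting x A) : Pairwise (Function.onFun Disjoint A) := by
  intro i j hij
  rw [Function.onFun, disjoint_iff_inter_eq_empty, ← not_nonempty_iff_eq_empty]
  exact fun h => hij (hA.1 (eq_of_mem_components (hA.mem_components i) (hA.mem_components j) h))

theorem exists_mem (hA : N.IsSplitting x A) {y : N.Point} (hy : y ≠ x) : ∃ i, y ∈ A i := by
  have : connectedComponentIn {x}ᶜ y ∈ range A := hA.2 ▸ ⟨y, hy, rfl⟩
  obtain ⟨i, hi⟩ := this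
  exact ⟨i, hi ▸ mem_connectedComponentIn hy⟩

theorem exists_subset (hA : N.IsSplitting x A) {T : Set N.Point} (hT : IsConnected T)
    (hx : x ∉ T) : ∃ i, T ⊆ A i := by
  obtain ⟨y, hy⟩ := hT.1
  obtain ⟨i, hi⟩ := hA.exists_mem (ne_of_mem_of_not_mem hy hx)
  exact ⟨i, subset_of_mem_components (hA.mem_components i) hT.2 hx ⟨y, hy, hi⟩⟩

theorem two_le (hA : N.IsSplitting x A) (hx : ¬ IsPreconnected ({x}ᶜ : Set N.Point)) :
    2 ≤ n := by
  by_contra! hn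
  refine hx ?_
  have hsub : ∀ y ∈ ({x}ᶜ : Set N.Point), ∃ i, y ∈ A i := fun y hy => hA.exists_mem hy
  refine isPreconnected_of_forall_pair fun y hy z hz => ?_
  obtain ⟨i, hi⟩ := hsub y hy
  obtain ⟨j, hj⟩ := hsub z hz
  -- With `n ≤ 1` there is at most one index, so any two points share a component.
  obtain rfl : i = j := Fin.ext (by omega)
  exact ⟨A i, subset_compl_singleton_iff.2 (notMem_of_mem_components (hA.mem_components i)),
    hi, hj, (isConnected_of_mem_components (hA.mem_components i)).2⟩

theorem radius_eq (hA : N.IsSplitting x A) : N.radius x = ⨆ i, N.length (A i) := by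
  rw [radius, ← hA.2, iSup_range]

theorem length_insert_biUnion (hA : N.IsSplitting x A) (S : Finset (Fin n)) :
    N.length (insert x (⋃ j ∈ S, A j)) = ∑ j ∈ S, N.length (A j) := by
  rw [measure_congr (insert_ae_eq_self x _), measure_biUnion_finset (fun i _ j _ hij => hA.pairwise_disjoint hij)
      fun i _ => hA.measurableSet i]

theorem isConnected_insert_biUnion (hA : N.IsSplitting x A) (S : Finset (Fin n)) :
    IsConnected (insert x (⋃ j ∈ S, A j)) := by
  refine ⟨⟨x, mem_insert _ _⟩, isPreconnected_of_forall x ?_⟩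
  rintro y (rfl | hy)
  · exact ⟨{y}, by simp, rfl, rfl, isPreconnected_singleton⟩
  · obtain ⟨j, hj, hy⟩ := mem_iUnion₂.1 hy
    exact ⟨insert x (A j), insert_subset_insert (subset_biUnion_of_mem (u := A) hj),
      mem_insert _ _, mem_insert_of_mem _ hy,
      (isConnected_insert_of_mem_components (hA.mem_components j)).2⟩

end IsSplitting

/-! ### Payoff of a fixed set against a random trap -/

theorem lintegral_payoff {C : Set N.Point} (hC : MeasurableSet C) (τ : Measure N.Point) :
    ∫⁻ y, N.payoff C y ∂τ = N.length C * τ Cᶜ := by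
  have h : N.payoff C = Cᶜ.indicator fun _ => N.length C := by
    ext y
    by_cases hy : y ∈ C <;> simp [payoff, hy]
  rw [h, lintegral_indicator_const hC.compl]

theorem ofReal_compLength {n : ℕ} (A : Fin n → Set N.Point) (i : Fin n) :
    ENNReal.ofReal (N.compLength A i) = N.length (A i) :=
  ENNReal.ofReal_toReal (measure_ne_top _ _)

/-- The length in the payoff cancels the length in the weight; only the probability that the trap
misses `C` survives. -/
theorem ofReal_mul_lintegral_payoff {C : Set N.Point} (hC : MeasurableSet C)
    (τ : Measure N.Point) [IsProbabilityMeasure τ] {a D : ℝ} (ha : 0 < a)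
    (hCa : N.length C = ENNReal.ofReal a) :
    ENNReal.ofReal (1 / a / D) * ∫⁻ y, N.payoff C y ∂τ =
      ENNReal.ofReal (1 / D * (1 - τ.real C)) := by
  rw [lintegral_payoff hC, hCa, ← ofReal_measureReal, probReal_compl_eq_one_sub hC,
    ← mul_assoc, mul_comm, mul_comm (ENNReal.ofReal (1 / a / D)), ← ENNReal.ofReal_mul ha.le,
    ← ENNReal.ofReal_mul (sub_nonneg.2 measureReal_le_one)]
  congr 1
  field_simp

/-! ### The partition strategy -/

theorem partitionDenom_nonneg {n : ℕ} (A : Fin n → Set N.Point) (S : Finset (Fin n)) :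
    0 ≤ N.partitionDenom A S := by
  have h : ∀ i, 0 ≤ N.compLength A i := fun i => ENNReal.toReal_nonneg
  exact add_nonneg (Finset.sum_nonneg fun i _ => one_div_nonneg.2 (h i))
    (one_div_nonneg.2 (Finset.sum_nonneg fun i _ => h i))

theorem sum_notMem_eq_sum_compl {n : ℕ} (S : Finset (Fin n)) (f : Fin n → ℝ) :
    ∑ i : {i : Fin n // i ∉ S}, f i = ∑ i ∈ Sᶜ, f i :=
  (Finset.sum_subtype Sᶜ (fun _ => Finset.mem_compl) f).symm

/-- For the outcome space of `consolidate`: its singletons are measurable, so Dirac integrals are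
evaluations. -/
instance discreteMeasurableSpace_sum {α β : Type*} [MeasurableSpace α] [MeasurableSpace β]
    [DiscreteMeasurableSpace α] [DiscreteMeasurableSpace β] : DiscreteMeasurableSpace (α ⊕ β) :=
  ⟨fun _ => measurableSet_sum_iff.2 ⟨.of_discrete, .of_discrete⟩⟩

theorem lintegral_consolidate {n : ℕ} (A : Fin n → Set N.Point) (x : N.Point)
    (S : Finset (Fin n)) (f : {i : Fin n // i ∉ S} ⊕ Unit → ℝ≥0∞) :
    ∫⁻ ω, f ω ∂(N.consolidate A x S).P =
      ∑ i : {i : Fin n // i ∉ S},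
        ENNReal.ofReal (1 / N.compLength A i / N.partitionDenom A S) * f (Sum.inl i) +
      ENNReal.ofReal (1 / (∑ j ∈ S, N.compLength A j) / N.partitionDenom A S) *
        f (Sum.inr ()) := by
  change ∫⁻ ω, f ω ∂(∑ i : {i : Fin n // i ∉ S},
        ENNReal.ofReal (1 / N.compLength A i / N.partitionDenom A S) • Measure.dirac (Sum.inl i) +
      ENNReal.ofReal (1 / (∑ j ∈ S, N.compLength A j) / N.partitionDenom A S) •
        Measure.dirac (Sum.inr ()) : Measure ({i : Fin n // i ∉ S} ⊕ Unit)) = _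
  rw [lintegral_add_measure, lintegral_finsetSum_measure, lintegral_smul_measure]
  simp only [lintegral_smul_measure, lintegral_dirac, smul_eq_mul]

namespace IsSplitting

variable {x : N.Point} {n : ℕ} {A : Fin n → Set N.Point}

theorem insert_biUnion_eq_compl (hA : N.IsSplitting x A) (S : Finset (Fin n)) :
    insert x (⋃ j ∈ S, A j) = (⋃ j ∈ Sᶜ, A j)ᶜ := by
  ext y
  simp only [mem_insert_iff, mem_iUnion, mem_compl_iff, Finset.mem_compl, not_exists]
  constructor
  · rintro (rfl | ⟨j, hj, hy⟩) i hi hyi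
    · exact notMem_of_mem_components (hA.mem_components i) hyi
    · exact (hA.pairwise_disjoint (ne_of_mem_of_not_mem hj hi)).le_bot ⟨hy, hyi⟩
  · intro h
    refine or_iff_not_imp_left.2 fun hne => ?_
    obtain ⟨i, hi⟩ := hA.exists_mem hne
    exact ⟨i, not_not.1 fun hiS => h i hiS hi, hi⟩

theorem measurableSet_biUnion (hA : N.IsSplitting x A) (S : Finset (Fin n)) :
    MeasurableSet (⋃ j ∈ S, A j) :=
  Finset.measurableSet_biUnion S fun i _ => hA.measurableSet i

theorem measureReal_insert_biUnion (hA : N.IsSplitting x A) (S : Finset (Fin n))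
    (τ : Measure N.Point) [IsProbabilityMeasure τ] :
    τ.real (insert x (⋃ j ∈ S, A j)) = 1 - ∑ j ∈ Sᶜ, τ.real (A j) := by
  rw [hA.insert_biUnion_eq_compl, probReal_compl_eq_one_sub (hA.measurableSet_biUnion _),
    measureReal_biUnion_finset (fun i _ j _ hij => hA.pairwise_disjoint hij)
      fun i _ => hA.measurableSet i]

theorem length_insert_biUnion_eq_ofReal (hA : N.IsSplitting x A) (S : Finset (Fin n)) :
    N.length (insert x (⋃ j ∈ S, A j)) = ENNReal.ofReal (∑ j ∈ S, N.compLength A j) := by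
  have h : ∀ i ∈ S, 0 ≤ N.compLength A i := fun i _ => ENNReal.toReal_nonneg
  rw [hA.length_insert_biUnion, ENNReal.ofReal_sum_of_nonneg h]
  exact Finset.sum_congr rfl fun i _ => (ofReal_compLength A i).symm

theorem isAttack_consolidate (hA : N.IsSplitting x A) (hpos : ∀ i, 0 < N.compLength A i)
    {S : Finset (Fin n)} (hS : S.Nonempty) : N.IsAttack (N.consolidate A x S) where
  prob := by
    have hD : 0 < N.partitionDenom A S :=
      add_pos_of_nonneg_of_pos (Finset.sum_nonneg fun i _ => one_div_nonneg.2 (hpos i).le)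
        (one_div_pos.2 (Finset.sum_pos (fun i _ => hpos i) hS))
    have h := lintegral_consolidate A x S fun _ => 1
    simp only [mul_one] at h
    refine ⟨lintegral_one.symm.trans (h.trans ?_)⟩
    have hnn : ∀ i ∈ (Finset.univ : Finset {i : Fin n // i ∉ S}),
        0 ≤ 1 / N.compLength A i / N.partitionDenom A S := fun i _ =>
      div_nonneg (one_div_nonneg.2 (hpos i).le) hD.le
    rw [← ENNReal.ofReal_sum_of_nonneg hnn, ← ENNReal.ofReal_add (Finset.sum_nonneg hnn)
        (div_nonneg (one_div_nonneg.2 (Finset.sum_nonneg fun i _ => (hpos i).le)) hD.le),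
      sum_notMem_eq_sum_compl S fun i => 1 / N.compLength A i / N.partitionDenom A S,
      ← Finset.sum_div, ← add_div]
    exact (congrArg _ (div_self hD.ne')).trans ENNReal.ofReal_one
  connected := by
    rintro (i | _)
    · exact isConnected_of_mem_components (hA.mem_components i)
    · exact hA.isConnected_insert_biUnion S
  measurable := by
    have hm : ∀ ω : {i : Fin n // i ∉ S} ⊕ Unit,
        MeasurableSet (Sum.elim (fun i : {i : Fin n // i ∉ S} => A i)
          (fun _ => insert x (⋃ j ∈ S, A j)) ω) := by
      rintro (i | _)
      · exact hA.measurableSet i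
      · exact (hA.measurableSet_biUnion S).insert x
    -- The outcome space is finite, so the graph is a finite union of measurable rectangles.
    have h := MeasurableSet.iUnion fun ω => (measurableSet_singleton ω).prod (hm ω)
    have heq : (⋃ ω, {ω} ×ˢ (Sum.elim (fun i : {i : Fin n // i ∉ S} => A i)
        (fun _ => insert x (⋃ j ∈ S, A j)) ω)) = {z : ({i : Fin n // i ∉ S} ⊕ Unit) × N.Point |
          z.2 ∈ (N.consolidate A x S).set z.1} := by
      ext ⟨ω, y⟩
      simp [consolidate]
    exact heq ▸ h

/-- The strategy equalizes over all trap laws: the piece containing `x` has `τ`-mass `1` minus that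
of the other pieces, so `τ` cancels from the sum. -/
theorem expectedPayoff_consolidate (hA : N.IsSplitting x A) (hpos : ∀ i, 0 < N.compLength A i)
    {S : Finset (Fin n)} (hS : S.Nonempty) (τ : Measure N.Point) [IsProbabilityMeasure τ] :
    N.expectedPayoff (N.consolidate A x S) τ = ENNReal.ofReal (N.W A S) := by
  have hD := partitionDenom_nonneg A S
  have hnn : ∀ C : Set N.Point, 0 ≤ 1 / N.partitionDenom A S * (1 - τ.real C) := fun C =>
    mul_nonneg (one_div_nonneg.2 hD) (sub_nonneg.2 measureReal_le_one)
  refine (lintegral_consolidate A x S fun ω => ∫⁻ y, N.payoff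
    (Sum.elim (fun i : {i : Fin n // i ∉ S} => A i)
      (fun _ => insert x (⋃ j ∈ S, A j)) ω) y ∂τ).trans ?_
  simp only [Sum.elim_inl, Sum.elim_inr]
  rw [ofReal_mul_lintegral_payoff ((hA.measurableSet_biUnion S).insert x) τ
      (Finset.sum_pos (fun i _ => hpos i) hS) (hA.length_insert_biUnion_eq_ofReal S),
    Finset.sum_congr rfl fun (i : {i : Fin n // i ∉ S}) _ => ofReal_mul_lintegral_payoff (hA.measurableSet i) τ (hpos i)
      (ofReal_compLength A i).symm,
    ← ENNReal.ofReal_sum_of_nonneg fun i _ => hnn _,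
    ← ENNReal.ofReal_add (Finset.sum_nonneg fun i _ => hnn _) (hnn _),
    sum_notMem_eq_sum_compl S fun i => 1 / N.partitionDenom A S * (1 - τ.real (A i)),
    hA.measureReal_insert_biUnion, ← Finset.mul_sum, Finset.sum_sub_distrib]
  have hcard : (Sᶜ.card : ℝ) = n - S.card := by
    rw [Finset.card_compl, Fintype.card_fin, Nat.cast_sub (card_finset_fin_le S)]
  congr 1
  simp only [W, Finset.sum_const, nsmul_eq_mul, hcard]
  ring

theorem le_attackGuarantee_consolidate (hA : N.IsSplitting x A)
    (hpos : ∀ i, 0 < N.compLength A i) {S : Finset (Fin n)} (hS : S.Nonempty) :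
    ENNReal.ofReal (N.W A S) ≤ N.attackGuarantee (N.consolidate A x S) :=
  le_iInf₂ fun τ hτ => by
    have : IsProbabilityMeasure τ := hτ
    exact (hA.expectedPayoff_consolidate hpos hS τ).ge

end IsSplitting

theorem exists_isPartitionStrategy {n : ℕ} (hn : 0 < n) (x : N.Point)
    (A : Fin n → Set N.Point) : ∃ σ, N.IsPartitionStrategy A x σ := by
  obtain ⟨S, hS, h⟩ := (Finset.univ.filter fun S : Finset (Fin n) => S.Nonempty).exists_max_image
    (N.W A) ⟨{⟨0, hn⟩}, by simp⟩
  exact ⟨_, S, by simpa using hS, fun T hT => h T (by simpa using hT), rfl⟩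

/-- For equal lengths and `k = |S|`, `W(S) = k (n - k) / (n (k (n - k) + 1))`, which is largest at
`k = n / 2`; only its value there is needed. -/
theorem W_of_card_eq_half {n : ℕ} (hn : 2 ≤ n) {A : Fin n → Set N.Point}
    (hlen : ∀ i, N.compLength A i = 1 / n) {S : Finset (Fin n)} (hS : n = 2 * S.card) :
    N.W A S = n / (n ^ 2 + 4) := by
  have hk : (0 : ℝ) < S.card := by exact_mod_cast (by omega : 0 < S.card)
  have hcard : (Sᶜ.card : ℝ) = S.card := by
    rw [Finset.card_compl, Fintype.card_fin]; congr 1; omega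
  have hn' : (n : ℝ) = 2 * S.card := by exact_mod_cast hS
  simp only [W, partitionDenom, hlen, Finset.sum_const, nsmul_eq_mul, hcard]
  rw [hn']
  field_simp
  ring

/-! ### The centroid strategy -/

/-- Pure attacks suffice, and only measurable ones, since sections of a measurable graph are
measurable. -/
theorem defenceGuarantee_le {τ : Measure N.Point} {w : ℝ≥0∞}
    (h : ∀ C : Set N.Point, IsConnected C → MeasurableSet C → N.length C * τ Cᶜ ≤ w) :
    N.defenceGuarantee τ ≤ w := by
  refine iSup₂_le fun σ hσ => ?_
  have := hσ.prob
  calc N.expectedPayoff σ τ ≤ ∫⁻ _, w ∂σ.P := by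
        refine lintegral_mono fun ω => ?_
        have hm : MeasurableSet (σ.set ω) := measurable_prodMk_left hσ.measurable
        rw [lintegral_payoff hm]
        exact h _ (hσ.connected ω) hm
    _ = w := by simp

theorem isDefence_centroidStrategy (x : N.Point) : N.IsDefence (N.centroidStrategy x) := by
  constructor
  simp only [centroidStrategy, Measure.add_apply, Measure.smul_apply, measure_univ, smul_eq_mul,
    mul_one]
  have ha : 0 ≤ (N.radius x).toReal := ENNReal.toReal_nonneg
  generalize (N.radius x).toReal = a at ha
  rw [← ENNReal.ofReal_add (by positivity), add_sub_cancel, ENNReal.ofReal_one]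
  rw [sub_nonneg, div_le_one (by positivity)]
  -- `p ≤ 1` amounts to `(2 a - 1) ^ 2 ≥ 0`.
  nlinarith [sq_nonneg (2 * a - 1)]

theorem centroidStrategy_real_compl (x : N.Point) {C : Set N.Point} (hC : MeasurableSet C)
    (a : ℝ) (ha : (N.radius x).toReal = a) :
    (N.centroidStrategy x).real Cᶜ = 4 * a / (1 + 4 * a ^ 2) * (1 - N.length.real C) +
      (1 - 4 * a / (1 + 4 * a ^ 2)) * Cᶜ.indicator 1 x := by
  have ha0 : 0 ≤ a := ha ▸ ENNReal.toReal_nonneg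
  have hp : 0 ≤ 1 - 4 * a / (1 + 4 * a ^ 2) := by
    rw [sub_nonneg, div_le_one (by positivity)]
    nlinarith [sq_nonneg (2 * a - 1)]
  have := Measure.smul_finite N.length (c := ENNReal.ofReal (4 * a / (1 + 4 * a ^ 2)))
    ENNReal.ofReal_ne_top
  have := Measure.smul_finite (Measure.dirac x) (c := ENNReal.ofReal (1 - 4 * a / (1 + 4 * a ^ 2)))
    ENNReal.ofReal_ne_top
  rw [centroidStrategy, ha, measureReal_add_apply (measure_lt_top _ _).ne (measure_lt_top _ _).ne,
    measureReal_ennreal_smul_apply, measureReal_ennreal_smul_apply,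
    ENNReal.toReal_ofReal (by positivity), ENNReal.toReal_ofReal hp,
    probReal_compl_eq_one_sub hC, measureReal_def (Measure.dirac x),
    Measure.dirac_apply' _ hC.compl]
  congr 2
  by_cases hx : x ∈ C <;> simp [hx]

theorem defenceGuarantee_centroidStrategy_le (x : N.Point)
    {n : ℕ} (hn : 2 ≤ n) {A : Fin n → Set N.Point} (hA : N.IsSplitting x A)
    (hlen : ∀ i, N.length (A i) = ENNReal.ofReal (1 / n)) :
    N.defenceGuarantee (N.centroidStrategy x) ≤ ENNReal.ofReal (n / (n ^ 2 + 4)) := by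
  have : Nonempty (Fin n) := ⟨⟨0, by omega⟩⟩
  have := isDefence_centroidStrategy x
  have hn' : (2 : ℝ) ≤ n := by exact_mod_cast hn
  have ha : (N.radius x).toReal = 1 / n := by
    rw [hA.radius_eq, iSup_congr hlen, ciSup_const, ENNReal.toReal_ofReal (by positivity)]
  have hp : 4 * (1 / n : ℝ) / (1 + 4 * (1 / n) ^ 2) = 4 * (n / (n ^ 2 + 4)) := by field_simp
  refine defenceGuarantee_le fun C hC hm => ?_
  rw [← ofReal_measureReal, ← ofReal_measureReal (μ := N.centroidStrategy x),
    ← ENNReal.ofReal_mul measureReal_nonneg]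
  refine ENNReal.ofReal_le_ofReal ?_
  rw [centroidStrategy_real_compl x hm _ ha, hp]
  set l := N.length.real C
  have hl : 0 ≤ l := measureReal_nonneg
  set w : ℝ := n / (n ^ 2 + 4)
  have hw : 0 ≤ w := by positivity
  by_cases hx : x ∈ C
  · have hx' : x ∉ Cᶜ := not_not.2 hx
    simp only [indicator_of_notMem hx', mul_zero, add_zero]
    -- `w - 4 w l (1 - l) = w (2 l - 1) ^ 2`.
    nlinarith [mul_nonneg hw (sq_nonneg (2 * l - 1))]
  · have hx' : x ∈ Cᶜ := hx
    simp only [indicator_of_mem hx', Pi.one_apply, mul_one]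
    have hl' : l ≤ 1 / n := by
      obtain ⟨i, hi⟩ := hA.exists_subset hC hx
      refine (measureReal_mono hi).trans_eq ?_
      rw [measureReal_def, hlen, ENNReal.toReal_ofReal (by positivity)]
    -- A whole component earns exactly `w`: this is what the choice of `p` balances.
    have hw1 : w = 1 / n - 4 * w * (1 / n) ^ 2 := by
      simp only [w]; field_simp; ring
    have hw4 : 4 * w * (2 / n) ≤ 1 := by
      have : 4 * w * (2 / n) = 8 / (n ^ 2 + 4) := by simp only [w]; field_simp; norm_num
      rw [this, div_le_one (by positivity)]
      nlinarith
    have h1 : 4 * w * (l + 1 / n) ≤ 1 :=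
      (mul_le_mul_of_nonneg_left (by linarith [show (2 : ℝ) / n = 1 / n + 1 / n by ring])
        (by positivity)).trans hw4
    -- By `hw1`, `w - l (1 - 4 w l) = (1 / n - l) (1 - 4 w (l + 1 / n))`, a product of nonnegative
    -- factors.
    nlinarith [mul_nonneg (sub_nonneg.2 hl') (sub_nonneg.2 h1)]

/-! ### Duality -/

theorem attackGuarantee_le_defenceGuarantee {σ : N.RandomSet} (hσ : N.IsAttack σ)
    {τ : Measure N.Point} (hτ : N.IsDefence τ) :
    N.attackGuarantee σ ≤ N.defenceGuarantee τ :=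
  (iInf₂_le τ hτ).trans (le_iSup₂ (f := fun σ (_ : N.IsAttack σ) => N.expectedPayoff σ τ) σ hσ)

theorem isOptimalAttack_of_le {σ : N.RandomSet} (hσ : N.IsAttack σ) {τ : Measure N.Point}
    (hτ : N.IsDefence τ) (h : N.defenceGuarantee τ ≤ N.attackGuarantee σ) :
    N.IsOptimalAttack σ :=
  ⟨hσ, fun _ hσ' => (attackGuarantee_le_defenceGuarantee hσ' hτ).trans h⟩

theorem isOptimalDefence_of_le {σ : N.RandomSet} (hσ : N.IsAttack σ) {τ : Measure N.Point}
    (hτ : N.IsDefence τ) (h : N.defenceGuarantee τ ≤ N.attackGuarantee σ) :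
    N.IsOptimalDefence τ :=
  ⟨hτ, fun _ hτ' => h.trans (attackGuarantee_le_defenceGuarantee hσ hτ')⟩

theorem hasValue_of_le {σ : N.RandomSet} (hσ : N.IsAttack σ) {τ : Measure N.Point}
    (hτ : N.IsDefence τ) {w : ℝ≥0∞} (hw : w ≤ N.attackGuarantee σ)
    (hw' : N.defenceGuarantee τ ≤ w) : N.HasValue w :=
  ⟨(iSup₂_le fun _ hσ' => (attackGuarantee_le_defenceGuarantee hσ' hτ).trans hw').antisymm
      (hw.trans (le_iSup₂ (f := fun σ (_ : N.IsAttack σ) => N.attackGuarantee σ) σ hσ)),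
    ((iInf₂_le τ hτ).trans hw').antisymm
      (le_iInf₂ fun _ hτ' => hw.trans (attackGuarantee_le_defenceGuarantee hσ hτ'))⟩

end Network

/-! ### Value and optimal strategies -/

theorem corollary13 (N : Network.{u, v}) (x : N.Point) (hx : N.IsCentroid x)
    (n : ℕ) (hn : Even n) (A : Fin n → Set N.Point) (hA : N.IsSplitting x A)
    (hlen : ∀ i, N.length (A i) = ENNReal.ofReal (1 / n)) :
    N.HasValue (ENNReal.ofReal (n / (n ^ 2 + 4))) ∧
      (∃ σ, N.IsPartitionStrategy A x σ) ∧
      (∀ σ, N.IsPartitionStrategy A x σ → N.IsOptimalAttack σ) ∧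
      N.IsOptimalDefence (N.centroidStrategy x) := by
  have hn2 : 2 ≤ n := hA.two_le hx.1
  have hcomp : ∀ i, N.compLength A i = 1 / n := fun i => by
    rw [Network.compLength, hlen, ENNReal.toReal_ofReal (by positivity)]
  have hpos : ∀ i, 0 < N.compLength A i := fun i => by
    rw [hcomp]
    exact one_div_pos.2 (Nat.cast_pos.2 (by omega))
  have hdef := Network.isDefence_centroidStrategy x
  have hub := Network.defenceGuarantee_centroidStrategy_le x hn2 hA hlen
  have hpart : ∀ σ, N.IsPartitionStrategy A x σ → N.IsAttack σ ∧
      ENNReal.ofReal (n / (n ^ 2 + 4)) ≤ N.attackGuarantee σ := by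
    rintro σ ⟨S, hS, hmax, rfl⟩
    refine ⟨hA.isAttack_consolidate hpos hS,
      le_trans (ENNReal.ofReal_le_ofReal ?_) (hA.le_attackGuarantee_consolidate hpos hS)⟩
    -- The maximizer `S` need not be identified: it is enough that it does no worse than some `T` of
    -- size `n / 2`, where evenness of `n` is used.
    obtain ⟨T, -, hT⟩ := Finset.exists_subset_card_eq (s := (Finset.univ : Finset (Fin n)))
      (n := n / 2) (by simp; omega)
    have hT' : n = 2 * T.card := by rw [hT]; exact (Nat.two_mul_div_two_of_even hn).symm
    rw [← Network.W_of_card_eq_half hn2 hcomp hT']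
    exact hmax T (Finset.card_pos.1 (by omega))
  obtain ⟨σ, hσ⟩ := Network.exists_isPartitionStrategy (by omega : 0 < n) x A
  obtain ⟨hatt, hlb⟩ := hpart σ hσ
  exact ⟨Network.hasValue_of_le hatt hdef hlb hub, ⟨σ, hσ⟩,
    fun σ' hσ' => Network.isOptimalAttack_of_le (hpart σ' hσ').1 hdef (hub.trans (hpart σ' hσ').2),
    Network.isOptimalDefence_of_le hatt hdef (hub.trans hlb)⟩
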